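/- Conventions. All vector spaces are real. A partially ordered vector space $E$ has a proper, not necessarily generating, positive cone $E^+$. It is monotone complete if every increasing net in $E$ that is bounded above has a supremum in $E$. A positive functional $x'\colon E\to\mathbb R$ is order continuous if $x'(x_\lambda)\downarrow 0$ whenever $x_\lambda\downarrow 0$ in $E$; $E$ is normal if, for $x\in E$, one has $x\in E^+$ if and only if $x'(x)\ge 0$ for all positive order continuous functionals $x'$ on $E$. Put $\overline E=E\cup\{\infty\}$ and $\overline{E^+}=E^+\cup\{\infty\}$, where $\infty$ is a largest element, $x+\infty=\infty$ for $x\in\overline E$, $r\cdot\infty=\infty$ for $r>0$, and $0\cdot\infty=0$. Let $X$ be a locally compact Hausdorff space with Borel $\sigma$-algebra $\mathcal B$, and let $E$ be monotone complete. A measure is a map $\mu\colon\mathcal B\to\overline{E^+}$ with $\mu(\emptyset)=0$ and $\mu(\bigcup_{n\ge1}\Delta_n)=\bigvee_{N\ge1}\sum_{n=1}^N\mu(\Delta_n)$ in $\overline E$ for all pairwise disjoint sequences $(\Delta_n)$ in $\mathcal B$. For an elementary function $\varphi=\sum_{i=1}^n r_i1_{\Delta_i}$ with $r_i\in[0,\infty)$,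 $\Delta_i\in\mathcal B$, put $\int\varphi\,d\mu=\sum_i r_i\mu(\Delta_i)$; for measurable $f\colon X\to[0,\infty]$ put $\int f\,d\mu=\bigvee_n\int\varphi_n\,d\mu$ in $\overline E$, where $(\varphi_n)$ is a sequence of elementary functions increasing pointwise to $f$; a measurable $f\colon X\to\mathbb R$ is integrable if $\int|f|\,d\mu\in E$, and then $\int f\,d\mu=\int f^+\,d\mu-\int f^-\,d\mu$. The measure $\mu$ represents a positive linear operator $\pi\colon C_c(X)\to E$ if every $f\in C_c(X)$ is integrable and $\pi(f)=\int f\,d\mu$. With all suprema and infima taken in $\overline E$, $\mu$ is: a Borel measure if $\mu(K)\in E$ for all compact $K$; inner regular at $\Delta$ if $\mu(\Delta)=\bigvee\{\mu(K): K\subseteq\Delta \text{ compact}\}$; weakly inner regular at $\Delta$ if $\mu(\Delta)=\bigvee\{\mu(\Delta\cap K): K\text{ compact}\}$; outer regular at $\Delta$ if $\mu(\Delta)=\bigwedge\{\mu(V): V\supseteq\Delta\text{ open}\}$; a regular Borel measure if it is a Borel measure that is inner regular at all open sets and outer regular at all Borel sets; a quasi-regular Borel measure if it is a Borel measure that is inner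 regular at all open sets and weakly inner regular at all Borel sets. Theorem (Riesz representation theorem for $C_c(X)$: normal case). Let $X$ be a locally compact Hausdorff space, let $E$ be a monotone complete and normal partially ordered vector space, and let $\pi\colon C_c(X)\to E$ be a positive linear operator. Then there exists a unique measure $\mu\colon\mathcal B\to\overline{E^+}$ such that: 1. for every open $U\subseteq X$ with compact closure, the restriction of $\mu$ to the Borel subsets of $U$ is a regular Borel measure on the space $U$; 2. $\mu$ is weakly inner regular at all Borel sets; 3. $\mu$ represents $\pi$. This measure $\mu$ is a quasi-regular Borel measure. If $\widetilde\mu$ is a regular Borel measure on $X$ that represents $\pi$, then $\widetilde\mu(\Delta)\ge\mu(\Delta)$ for all $\Delta\in\mathcal B$. Furthermore, $\widetilde\mu$ and $\mu$ agree at all open subsets of $X$, at all compact subsets of $X$, at all Borel sets $\Delta$ with $\widetilde\mu(\Delta)\in E$, and at all Borel sets $\Delta$ with $\mu(\Delta)=\infty$. -/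

import Mathlib

open scoped NNReal ENNReal CompactlySupported

namespace OrderedMeasure

section Order

/-- Monotone completeness: every increasing net that is bounded above has a supremum.
The range of an increasing net is a non-empty upward directed set, and every such set is the range
of an increasing net, so the property is stated for directed sets. -/
def IsMonotoneComplete (E : Type*) [PartialOrder E] : Prop :=
  ∀ S : Set E, S.Nonempty → DirectedOn (· ≤ ·) S → BddAbove S → ∃ x, IsLUB S x

/-- Order continuity of a positive operator: `x_i ↓ 0` implies `T x_i ↓ 0`. Decreasing nets are
again replaced by their ranges, the non-empty downward directed sets. -/
def IsOrderContinuous {E F : Type*} [AddCommGroup E] [PartialOrder E] [Module ℝ E]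
    [AddCommGroup F] [PartialOrder F] [Module ℝ F] (T : E →ₚ[ℝ] F) : Prop :=
  ∀ S : Set E, S.Nonempty → DirectedOn (· ≥ ·) S → IsGLB S 0 → IsGLB (T '' S) 0

/-- Normality: the positive order continuous functionals determine the positive cone. -/
def IsNormalSpace (E : Type*) [AddCommGroup E] [PartialOrder E] [Module ℝ E] : Prop :=
  ∀ x : E, (∀ φ : E →ₚ[ℝ] ℝ, IsOrderContinuous φ → 0 ≤ φ x) ↔ 0 ≤ x

end Order

/-- A positive measure on the σ-algebra of a measurable space `X` with values in `E ∪ {∞}`,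
which is `WithTop E`. As for `MeasureTheory.VectorMeasure`, it is a function of all sets that
carries the dummy value `0` at the sets that are not measurable, so that two measures are equal
if and only if they agree at the measurable sets. -/
structure ExtMeasure (X : Type*) [MeasurableSpace X] (E : Type*) [AddCommGroup E]
    [PartialOrder E] where
  /-- The underlying set function. -/
  toFun : Set X → WithTop E
  nonneg : ∀ s, 0 ≤ toFun s
  empty : toFun ∅ = 0
  not_measurable : ∀ s, ¬ MeasurableSet s → toFun s = 0
  sigma_additive : ∀ s : ℕ → Set X, (∀ n, MeasurableSet (s n)) →
    Pairwise (fun m n => Disjoint (s m) (s n)) →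
    IsLUB (Set.range fun N : ℕ => ∑ n ∈ Finset.range (N + 1), toFun (s n)) (toFun (⋃ n, s n))

namespace ExtMeasure

section Basic

variable {X : Type*} [MeasurableSpace X] {E : Type*} [AddCommGroup E] [PartialOrder E]

instance : CoeFun (ExtMeasure X E) (fun _ => Set X → WithTop E) := ⟨toFun⟩

open Classical in
/-- The restriction of a measure to the measurable subsets of a measurable set `U`, as a measure on
the subspace `U`. -/
noncomputable def restrict (μ : ExtMeasure X E) (U : Set X) (hU : MeasurableSet U) :
    ExtMeasure U E where
  toFun s := if MeasurableSet s then μ (Subtype.val '' s) else 0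
  nonneg s := by
    split_ifs
    · exact μ.nonneg _
    · exact le_rfl
  empty := by simp [μ.empty]
  not_measurable s hs := if_neg hs
  sigma_additive s hs hd := by
    have h := μ.sigma_additive (fun n => Subtype.val '' s n)
      (fun n => hU.subtype_image (hs n))
      (fun m n hmn => Set.disjoint_image_of_injective Subtype.val_injective (hd hmn))
    rw [if_pos (MeasurableSet.iUnion hs), Set.image_iUnion]
    simpa only [if_pos (hs _)] using h

end Basic

section Integral

variable {X : Type*} [MeasurableSpace X] {E : Type*} [AddCommGroup E] [PartialOrder E]
  [Module ℝ E]

/-- The product `r • x` in `E ∪ {∞}` for `0 ≤ r`, with `r • ∞ = ∞` for `0 < r` and `0 • ∞ = 0`. -/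
noncomputable def extSMul (r : ℝ≥0) (x : WithTop E) : WithTop E :=
  if r = 0 then 0 else x.map (fun y => (r : ℝ) • y)

/-- The order integral of an elementary function, an element of `E ∪ {∞}`. -/
noncomputable def elemIntegral (μ : ExtMeasure X E) (φ : MeasureTheory.SimpleFunc X ℝ≥0) :
    WithTop E :=
  ∑ r ∈ φ.range, extSMul r (μ (φ ⁻¹' {r}))

/-- `a ∈ E ∪ {∞}` is the order integral of `f : X → [0, ∞]`: it is the supremum of the integrals of
the terms of a sequence of elementary functions that increases to `f` pointwise. -/
def HasPosIntegral (μ : ExtMeasure X E) (f : X → ℝ≥0∞) (a : WithTop E) : Prop :=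
  ∃ φ : ℕ → MeasureTheory.SimpleFunc X ℝ≥0,
    (∀ x, Monotone fun n => φ n x) ∧ (∀ x, ⨆ n, (φ n x : ℝ≥0∞) = f x) ∧
    IsLUB (Set.range fun n => μ.elemIntegral (φ n)) a

/-- The real function `f` is integrable and `x ∈ E` is its order integral: `f` is measurable, the
integral of `|f|` is finite, and `x` is the difference of the integrals of the positive and negative
parts of `f`. -/
def HasOrderIntegral (μ : ExtMeasure X E) (f : X → ℝ) (x : E) : Prop :=
  Measurable f ∧
  (∃ c : E, μ.HasPosIntegral (fun t => ENNReal.ofReal |f t|) c) ∧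
  ∃ a b : E, μ.HasPosIntegral (fun t => ENNReal.ofReal (f t)) a ∧
    μ.HasPosIntegral (fun t => ENNReal.ofReal (-f t)) b ∧ x = a - b

end Integral

section Regularity

variable {X : Type*} [TopologicalSpace X] [MeasurableSpace X] {E : Type*} [AddCommGroup E]
  [PartialOrder E]

/-- `μ` is a Borel measure: it is finite at compact sets. -/
def IsBorel (μ : ExtMeasure X E) : Prop := ∀ K, IsCompact K → μ K ≠ ⊤

/-- Inner regularity at `D`; the supremum is taken in `E ∪ {∞}`. -/
def InnerRegularAt (μ : ExtMeasure X E) (D : Set X) : Prop :=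
  IsLUB {a | ∃ K, IsCompact K ∧ K ⊆ D ∧ a = μ K} (μ D)

/-- Weak inner regularity at `D`; the supremum is taken in `E ∪ {∞}`. -/
def WeaklyInnerRegularAt (μ : ExtMeasure X E) (D : Set X) : Prop :=
  IsLUB {a | ∃ K, IsCompact K ∧ a = μ (D ∩ K)} (μ D)

/-- Outer regularity at `D`; the infimum is taken in `E ∪ {∞}`. -/
def OuterRegularAt (μ : ExtMeasure X E) (D : Set X) : Prop :=
  IsGLB {a | ∃ V, IsOpen V ∧ D ⊆ V ∧ a = μ V} (μ D)

structure IsRegularBorel (μ : ExtMeasure X E) : Prop where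
  isBorel : μ.IsBorel
  innerRegular : ∀ V, IsOpen V → μ.InnerRegularAt V
  outerRegular : ∀ D, MeasurableSet D → μ.OuterRegularAt D

structure IsQuasiRegularBorel (μ : ExtMeasure X E) : Prop where
  isBorel : μ.IsBorel
  innerRegular : ∀ V, IsOpen V → μ.InnerRegularAt V
  weaklyInnerRegular : ∀ D, MeasurableSet D → μ.WeaklyInnerRegularAt D

/-- For every relatively compact open set `U`, the restriction of `μ` to `U` is a regular Borel
measure on the space `U`. -/
def IsLocallyRegularBorel [BorelSpace X] (μ : ExtMeasure X E) : Prop :=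
  ∀ (U : Set X) (hU : IsOpen U), IsCompact (closure U) →
    (μ.restrict U hU.measurableSet).IsRegularBorel

/-- `μ` represents `π`: every `f` in `C_c(X, ℝ)` is integrable with integral `π f`. -/
def Represents [Module ℝ E] (μ : ExtMeasure X E) (π : C_c(X, ℝ) →ₚ[ℝ] E) : Prop :=
  ∀ f : C_c(X, ℝ), μ.HasOrderIntegral f (π f)

end Regularity

end ExtMeasure

end OrderedMeasure

namespace OrderedMeasure

/-! ### Elements of `E` prescribed by the values of order continuous functionals -/

section OrderContinuous

variable {E : Type*} [AddCommGroup E] [PartialOrder E] [Module ℝ E]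

/-! The problem is reduced to the scalar Riesz theorem. For a positive functional `φ` on `E`, the
functional `φ ∘ π` has a Riesz measure `m_φ`. By normality an element of `E` is determined by its
values under the order continuous `φ`, so `μ D` is defined as the element `e` with `φ e = sup_K m_φ
(D ∩ K)` for all such `φ`, `K` compact, and as `∞` if there is none. The supremum over `K` forces
weak inner regularity; `m_φ D` itself may be larger when `D` lies in no compact set.

Existence of `e` comes from monotone completeness. For `D` open and relatively compact, `e` is the
supremum of the `π f` with `0 ≤ f ≤ 1` supported in `D`. A Dynkin class argument gives the Borel
subsets of compact sets, and a supremum over compact sets gives every `D` for which these values are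
bounded above. By `HasValue.isLUB` and `HasValue.isGLB`, suprema and infima in `E ∪ {∞}` can be
checked on functionals, so σ-additivity, regularity and representation follow from the scalar case.

For uniqueness, a measure representing `π` and inner regular at an open `V` has `μ V = sup π f` over
the same kind of `f`. Two such measures agree at relatively compact open sets, hence at Borel
subsets of compact sets, hence everywhere by weak inner regularity. For a regular `ν`, outer
regularity encloses a set of finite measure in an open set of finite measure, where the same
argument applies. -/

theorem IsOrderContinuous.isLUB_image [IsOrderedAddMonoid E] {φ : E →ₚ[ℝ] ℝ}
    (hφ : IsOrderContinuous φ) {S : Set E} (hne : S.Nonempty) (hdir : DirectedOn (· ≤ ·) S) {x : E}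
    (hx : IsLUB S x) : IsLUB (φ '' S) (φ x) := by
  have h := hφ ((fun s => x - s) '' S) (hne.image _) ?_ ?_
  · constructor
    · rintro _ ⟨s, hs, rfl⟩
      exact OrderHomClass.mono φ (hx.1 hs)
    · intro b hb
      have : φ x - b ∈ lowerBounds (φ '' ((fun s => x - s) '' S)) := by
        rintro _ ⟨_, ⟨s, hs, rfl⟩, rfl⟩
        have := hb ⟨s, hs, rfl⟩
        simp only [map_sub]
        linarith
      have := h.2 this
      linarith
  · rintro _ ⟨s, hs, rfl⟩ _ ⟨t, ht, rfl⟩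
    obtain ⟨u, hu, hsu, htu⟩ := hdir s hs t ht
    exact ⟨x - u, ⟨u, hu, rfl⟩, sub_le_sub_left hsu x, sub_le_sub_left htu x⟩
  · constructor
    · rintro _ ⟨s, hs, rfl⟩
      exact sub_nonneg.2 (hx.1 hs)
    · intro b hb
      have : x - b ∈ upperBounds S := fun s hs => le_sub_comm.1 (hb ⟨s, hs, rfl⟩)
      simpa using hx.2 this

theorem IsNormalSpace.le_of_forall [IsOrderedAddMonoid E] (hE : IsNormalSpace E) {x y : E}
    (h : ∀ φ : E →ₚ[ℝ] ℝ, IsOrderContinuous φ → φ x ≤ φ y) : x ≤ y :=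
  sub_nonneg.1 <| (hE _).1 fun φ hφ => by simpa using h φ hφ

/-- The element `e` is positive, and the order continuous functionals take the values prescribed by
`c` at `e`. -/
def HasValue (e : E) (c : (E →ₚ[ℝ] ℝ) → ℝ≥0∞) : Prop :=
  0 ≤ e ∧ ∀ φ, IsOrderContinuous φ → ENNReal.ofReal (φ e) = c φ

namespace HasValue

theorem zero : HasValue (0 : E) (fun _ => 0) := ⟨le_rfl, fun φ _ => by simp⟩

theorem congr {e : E} {c d : (E →ₚ[ℝ] ℝ) → ℝ≥0∞} (h : HasValue e c)
    (hcd : ∀ φ, IsOrderContinuous φ → c φ = d φ) : HasValue e d :=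
  ⟨h.1, fun φ hφ => (h.2 φ hφ).trans (hcd φ hφ)⟩

variable {e e' : E} {c c' : (E →ₚ[ℝ] ℝ) → ℝ≥0∞}

theorem add [IsOrderedAddMonoid E] (h : HasValue e c) (h' : HasValue e' c') :
    HasValue (e + e') (fun φ => c φ + c' φ) :=
  ⟨add_nonneg h.1 h'.1, fun φ hφ => by
    rw [map_add, ENNReal.ofReal_add (φ.map_nonneg h.1) (φ.map_nonneg h'.1), h.2 φ hφ, h'.2 φ hφ]⟩

theorem sum [IsOrderedAddMonoid E] {ι : Type*} {s : Finset ι} {v : ι → E}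
    {c : ι → (E →ₚ[ℝ] ℝ) → ℝ≥0∞} (h : ∀ i ∈ s, HasValue (v i) (c i)) :
    HasValue (∑ i ∈ s, v i) (fun φ => ∑ i ∈ s, c i φ) := by
  classical
  induction s using Finset.induction_on with
  | empty => simpa using zero
  | insert a s ha ih =>
    simp only [Finset.sum_insert ha]
    exact (h a (by simp)).add (ih fun i hi => h i (by simp [hi]))

theorem smul [IsOrderedModule ℝ E] (r : ℝ≥0) (h : HasValue e c) :
    HasValue ((r : ℝ) • e) (fun φ => r * c φ) :=
  ⟨smul_nonneg r.2 h.1, fun φ hφ => by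
    rw [map_smul, smul_eq_mul, ENNReal.ofReal_mul r.coe_nonneg, h.2 φ hφ, ENNReal.ofReal_coe_nnreal]⟩

variable [IsOrderedAddMonoid E]

theorem le (hE : IsNormalSpace E) (h : HasValue e c) (h' : HasValue e' c')
    (hcc : ∀ φ, IsOrderContinuous φ → c φ ≤ c' φ) : e ≤ e' :=
  hE.le_of_forall fun φ hφ => by
    have := hcc φ hφ
    rw [← h.2 φ hφ, ← h'.2 φ hφ] at this
    exact (ENNReal.ofReal_le_ofReal_iff (φ.map_nonneg h'.1)).1 this

theorem unique (hE : IsNormalSpace E) (h : HasValue e c) (h' : HasValue e' c) : e = e' :=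
  le_antisymm (h.le hE h' fun _ _ => le_rfl) (h'.le hE h fun _ _ => le_rfl)

/-- The hypothesis is additive because truncated subtraction in `ℝ≥0∞` would lose information.
Normality supplies the positivity of `e - e'`. -/
theorem sub (hE : IsNormalSpace E) (h : HasValue e c) (h' : HasValue e' c')
    {d : (E →ₚ[ℝ] ℝ) → ℝ≥0∞} (hd : ∀ φ, IsOrderContinuous φ → d φ + c' φ = c φ) :
    HasValue (e - e') d := by
  refine ⟨sub_nonneg.2 (h'.le hE h fun φ hφ => ?_), fun φ hφ => ?_⟩
  · rw [← hd φ hφ]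
    exact le_add_self
  · rw [map_sub, ENNReal.ofReal_sub _ (φ.map_nonneg h'.1), h.2 φ hφ, ← hd φ hφ, h'.2 φ hφ]
    refine ENNReal.add_sub_cancel_right ?_
    rw [← h'.2 φ hφ]
    exact ENNReal.ofReal_ne_top

variable {ι : Type*} {v : ι → E} {d : ι → (E →ₚ[ℝ] ℝ) → ℝ≥0∞}

/-- No directedness is needed: an upper bound `b` in `E` is positive, so it is compared with `e`
through its own values. -/
theorem isLUB [Nonempty ι] (hE : IsNormalSpace E) (hv : ∀ i, HasValue (v i) (d i))
    (h : HasValue e fun φ => ⨆ i, d i φ) :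
    IsLUB (Set.range fun i => (v i : WithTop E)) e := by
  constructor
  · rintro _ ⟨i, rfl⟩
    exact WithTop.coe_le_coe.2 ((hv i).le hE h fun φ _ => le_iSup (fun i => d i φ) i)
  · intro b hb
    induction b using WithTop.recTopCoe with
    | top => exact le_top
    | coe b =>
      have hb' : ∀ i, v i ≤ b := fun i => WithTop.coe_le_coe.1 (hb ⟨i, rfl⟩)
      obtain ⟨i₀⟩ := ‹Nonempty ι›
      have hb0 : 0 ≤ b := (hv i₀).1.trans (hb' i₀)
      refine WithTop.coe_le_coe.2 (h.le hE ⟨hb0, fun φ _ => rfl⟩ fun φ hφ => iSup_le fun i => ?_)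
      rw [← (hv i).2 φ hφ]
      exact ENNReal.ofReal_le_ofReal (OrderHomClass.mono φ (hb' i))

theorem isGLB [Nonempty ι] (hE : IsNormalSpace E) (hv : ∀ i, HasValue (v i) (d i))
    (h : HasValue e fun φ => ⨅ i, d i φ) :
    IsGLB (Set.range fun i => (v i : WithTop E)) e := by
  constructor
  · rintro _ ⟨i, rfl⟩
    exact WithTop.coe_le_coe.2 (h.le hE (hv i) fun φ _ => iInf_le (fun i => d i φ) i)
  · intro b hb
    obtain ⟨i₀⟩ := ‹Nonempty ι›
    induction b using WithTop.recTopCoe with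
    | top => exact absurd (hb ⟨i₀, rfl⟩) (by simp)
    | coe b =>
      have hb' : ∀ i, b ≤ v i := fun i => WithTop.coe_le_coe.1 (hb ⟨i, rfl⟩)
      refine WithTop.coe_le_coe.2 (hE.le_of_forall fun φ hφ => ?_)
      rw [← ENNReal.ofReal_le_ofReal_iff (φ.map_nonneg h.1), h.2 φ hφ]
      refine le_iInf fun i => ?_
      rw [← (hv i).2 φ hφ]
      exact ENNReal.ofReal_le_ofReal (OrderHomClass.mono φ (hb' i))

/-- Completeness produces the supremum in `E`, and order continuity carries it through every
functional. -/
theorem exists_iSup [Nonempty ι] (hE : IsMonotoneComplete E) (hv : ∀ i, HasValue (v i) (d i))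
    (hdir : Directed (· ≤ ·) v) (hbdd : BddAbove (Set.range v)) :
    ∃ e, HasValue e fun φ => ⨆ i, d i φ := by
  obtain ⟨e, he⟩ := hE _ (Set.range_nonempty v) hdir.directedOn_range hbdd
  have hle : ∀ i, v i ≤ e := fun i => he.1 ⟨i, rfl⟩
  refine ⟨e, (hv (Classical.arbitrary ι)).1.trans (hle _), fun φ hφ => le_antisymm ?_ ?_⟩
  · have hlub := hφ.isLUB_image (Set.range_nonempty v) hdir.directedOn_range he
    -- `toReal` sends `⊤` to `0`, so this case is set aside before passing to real numbers.
    rcases eq_or_ne (⨆ i, d i φ) ⊤ with htop | htop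
    · exact le_top.trans_eq htop.symm
    · refine ENNReal.ofReal_le_of_le_toReal (hlub.2 ?_)
      rintro _ ⟨_, ⟨i, rfl⟩, rfl⟩
      refine (ENNReal.ofReal_le_iff_le_toReal htop).1 ?_
      rw [(hv i).2 φ hφ]
      exact le_iSup (fun i => d i φ) i
  · refine iSup_le fun i => ?_
    rw [← (hv i).2 φ hφ]
    exact ENNReal.ofReal_le_ofReal (OrderHomClass.mono φ (hle i))

end HasValue

end OrderContinuous

namespace ExtMeasure

/-! ### Additivity, monotonicity and continuity from below -/

section Additivity

variable {X : Type*} [MeasurableSpace X] {E : Type*} [AddCommGroup E] [PartialOrder E]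

theorem ext_of_measurable {μ ν : ExtMeasure X E} (h : ∀ s, MeasurableSet s → μ s = ν s) :
    μ = ν := by
  have : μ.toFun = ν.toFun := by
    funext s
    by_cases hs : MeasurableSet s
    · exact h s hs
    · rw [μ.not_measurable s hs, ν.not_measurable s hs]
  cases μ
  cases ν
  congr

variable [IsOrderedAddMonoid E] (μ : ExtMeasure X E)

theorem apply_union {A B : Set X} (hA : MeasurableSet A) (hB : MeasurableSet B)
    (hAB : Disjoint A B) : μ (A ∪ B) = μ A + μ B := by
  let s : ℕ → Set X := fun n => if n = 0 then A else if n = 1 then B else ∅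
  have hs : ∀ n, MeasurableSet (s n) := fun n => by
    dsimp only [s]
    split_ifs <;> simp [hA, hB]
  have hd : Pairwise (fun m n => Disjoint (s m) (s n)) := by
    intro m n hmn
    dsimp only [s]
    split_ifs <;> simp_all [hAB.symm]
  have hU : ⋃ n, s n = A ∪ B := by
    ext x
    simp only [Set.mem_iUnion, Set.mem_union]
    constructor
    · rintro ⟨n, hn⟩
      dsimp only [s] at hn
      split_ifs at hn
      exacts [Or.inl hn, Or.inr hn, hn.elim]
    · rintro (h | h)
      · exact ⟨0, h⟩
      · exact ⟨1, h⟩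
  have hlub := μ.sigma_additive s hs hd
  rw [hU] at hlub
  have hsum : ∀ N : ℕ, ∑ n ∈ Finset.range (N + 2), μ (s n) = μ A + μ B := by
    intro N
    induction N with
    | zero => simp [Finset.sum_range_succ, s]
    | succ N ih => rw [Finset.sum_range_succ, ih]; simp [s, μ.empty]
  -- The partial sum with index `0` is only `μ A`; from index `1` on the sums are constant, so the
  -- supremum is attained.
  refine hlub.unique (IsGreatest.isLUB ⟨⟨1, hsum 0⟩, ?_⟩)
  rintro _ ⟨N, rfl⟩
  rcases N with _ | N
  · simpa [s] using le_add_of_nonneg_right (a := μ A) (μ.nonneg B)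
  · exact (hsum N).le

theorem apply_inter_add_diff {A D : Set X} (hA : MeasurableSet A) (hD : MeasurableSet D) :
    μ (A ∩ D) + μ (A \ D) = μ A := by
  rw [← μ.apply_union (hA.inter hD) (hA.diff hD)
    (Set.disjoint_sdiff_right.mono_left Set.inter_subset_right), Set.inter_union_sdiff]

theorem mono {A B : Set X} (hA : MeasurableSet A) (hB : MeasurableSet B) (h : A ⊆ B) :
    μ A ≤ μ B := by
  rw [← μ.apply_inter_add_diff hB hA, Set.inter_eq_self_of_subset_right h]
  exact le_add_of_nonneg_right (μ.nonneg _)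

theorem apply_biUnion_finset {ι : Type*} (t : Finset ι) {s : ι → Set X}
    (hs : ∀ i, MeasurableSet (s i)) (hd : Pairwise (fun i j => Disjoint (s i) (s j))) :
    μ (⋃ i ∈ t, s i) = ∑ i ∈ t, μ (s i) := by
  classical
  induction t using Finset.induction_on with
  | empty => simp [μ.empty]
  | insert a t ha ih =>
    rw [Finset.set_biUnion_insert, Finset.sum_insert ha, ← ih, μ.apply_union (hs a)
      (t.measurableSet_biUnion fun i _ => hs i)]
    exact Set.disjoint_iUnion₂_right.2 fun i hi => hd fun h => ha (h ▸ hi)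

theorem isLUB_iUnion {s : ℕ → Set X} (hs : ∀ n, MeasurableSet (s n)) (hm : Monotone s) :
    IsLUB (Set.range fun n => μ (s n)) (μ (⋃ n, s n)) := by
  have h := μ.sigma_additive (disjointed s) (fun n => MeasurableSet.disjointed hs n)
    (disjoint_disjointed s)
  rw [iUnion_disjointed] at h
  convert h using 3 with N
  symm
  induction N with
  | zero => simp
  | succ N ih =>
    rw [Finset.sum_range_succ, ih, hm.disjointed_add_one,
      ← μ.apply_inter_add_diff (hs (N + 1)) (hs N),
      Set.inter_eq_self_of_subset_right (hm N.le_succ)]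

theorem apply_eq_sum_inter_preimage (φ : MeasureTheory.SimpleFunc X ℝ≥0) {B : Set X}
    (hB : MeasurableSet B) : μ B = ∑ r ∈ φ.range, μ (B ∩ φ ⁻¹' {r}) := by
  rw [← μ.apply_biUnion_finset φ.range (fun r => hB.inter (φ.measurableSet_fiber r)),
    ← Set.inter_iUnion₂]
  · congr 1
    refine (Set.inter_eq_left.2 fun x _ => ?_).symm
    simp
  · intro r s hrs
    refine Disjoint.mono Set.inter_subset_right Set.inter_subset_right ?_
    exact Disjoint.preimage _ (by simpa using hrs)

/-- Dynkin's π-λ argument inside `V`, run on `V ∩ D`. Finiteness of `μ V` permits cancellation at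
complements. -/
theorem eq_of_eq_on_isOpen [TopologicalSpace X] [BorelSpace X] {μ ν : ExtMeasure X E} {V : Set X}
    (hV : IsOpen V) (hfin : μ V ≠ ⊤) (h : ∀ W, IsOpen W → W ⊆ V → μ W = ν W) {D : Set X}
    (hD : MeasurableSet D) (hDV : D ⊆ V) : μ D = ν D := by
  have hVm := hV.measurableSet
  suffices μ (V ∩ D) = ν (V ∩ D) by rwa [Set.inter_eq_self_of_subset_right hDV] at this
  clear hDV
  induction D, hD using MeasurableSpace.induction_on_inter (BorelSpace.measurable_eq (α := X))
    isPiSystem_isOpen with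
  | empty => simp [μ.empty, ν.empty]
  | basic t ht => exact h _ (hV.inter ht) Set.inter_subset_left
  | compl t ht ih =>
    have hμ := μ.apply_inter_add_diff hVm ht
    have hν := ν.apply_inter_add_diff hVm ht
    have hne : ν (V ∩ t) ≠ ⊤ := fun hc => hfin <| by
      rw [← hμ, ih, hc, WithTop.top_add]
    rw [← Set.sdiff_eq_compl_inter.trans (Set.inter_comm _ _)]
    refine WithTop.add_left_cancel hne ?_
    rw [hν, ← ih, hμ]
    exact h V hV subset_rfl
  | iUnion f hd hf ih =>
    have hμ := μ.sigma_additive (fun n => V ∩ f n) (fun n => hVm.inter (hf n))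
      (fun m n hmn => (hd hmn).mono Set.inter_subset_right Set.inter_subset_right)
    have hν := ν.sigma_additive (fun n => V ∩ f n) (fun n => hVm.inter (hf n))
      (fun m n hmn => (hd hmn).mono Set.inter_subset_right Set.inter_subset_right)
    simp only [ih, ← Set.inter_iUnion] at hμ hν
    exact hμ.unique hν

end Additivity

/-! ### Scalar multiples and integrals of elementary functions -/

section ExtSMul

variable {E : Type*} [AddCommGroup E] [Module ℝ E]

@[simp]
theorem extSMul_zero_left (x : WithTop E) : extSMul 0 x = 0 := if_pos rfl

@[simp]
theorem extSMul_coe (r : ℝ≥0) (x : E) : extSMul r (x : WithTop E) = ((r : ℝ) • x : E) := by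
  unfold extSMul
  split_ifs with h
  · simp [h]
  · rfl

@[simp]
theorem extSMul_zero (r : ℝ≥0) : extSMul r (0 : WithTop E) = 0 := by
  rw [← WithTop.coe_zero, extSMul_coe, smul_zero]

theorem extSMul_top {r : ℝ≥0} (hr : r ≠ 0) : extSMul r (⊤ : WithTop E) = ⊤ := by
  simp [extSMul, hr]

theorem extSMul_one (x : WithTop E) : extSMul 1 x = x := by
  induction x using WithTop.recTopCoe with
  | top => exact extSMul_top one_ne_zero
  | coe x => simp

theorem extSMul_add (r : ℝ≥0) (x y : WithTop E) :
    extSMul r (x + y) = extSMul r x + extSMul r y := by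
  rcases eq_or_ne r 0 with rfl | hr
  · simp
  induction x using WithTop.recTopCoe with
  | top => simp [extSMul_top hr]
  | coe x =>
    induction y using WithTop.recTopCoe with
    | top => simp [extSMul_top hr]
    | coe y => simp [← WithTop.coe_add]

theorem extSMul_sum (r : ℝ≥0) {ι : Type*} (s : Finset ι) (x : ι → WithTop E) :
    extSMul r (∑ i ∈ s, x i) = ∑ i ∈ s, extSMul r (x i) := by
  classical
  induction s using Finset.induction_on with
  | empty => simp
  | insert a s ha ih => rw [Finset.sum_insert ha, Finset.sum_insert ha, extSMul_add, ih]

theorem extSMul_le_extSMul [PartialOrder E] [IsOrderedAddMonoid E] [IsOrderedModule ℝ E] {r s : ℝ≥0} (hrs : r ≤ s)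
    {x y : WithTop E} (hx : 0 ≤ x) (hxy : x ≤ y) : extSMul r x ≤ extSMul s y := by
  rcases eq_or_ne s 0 with rfl | hs
  · simp [nonpos_iff_eq_zero.1 hrs]
  induction y using WithTop.recTopCoe with
  | top => simp [extSMul_top hs]
  | coe y =>
    lift x to E using ne_top_of_le_ne_top WithTop.coe_ne_top hxy
    have hx' : 0 ≤ x := WithTop.coe_le_coe.1 hx
    have hxy' : x ≤ y := WithTop.coe_le_coe.1 hxy
    simp only [extSMul_coe, WithTop.coe_le_coe]
    calc (r : ℝ) • x ≤ (s : ℝ) • x := smul_le_smul_of_nonneg_right (by exact_mod_cast hrs) hx'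
      _ ≤ (s : ℝ) • y := smul_le_smul_of_nonneg_left hxy' s.2

theorem extSMul_nonneg [PartialOrder E] [IsOrderedAddMonoid E] [IsOrderedModule ℝ E] (r : ℝ≥0) {x : WithTop E}
    (hx : 0 ≤ x) : 0 ≤ extSMul r x := by
  simpa using extSMul_le_extSMul (le_refl r) le_rfl hx

end ExtSMul

section Integral

variable {X : Type*} [MeasurableSpace X] {E : Type*} [AddCommGroup E] [PartialOrder E]
  [IsOrderedAddMonoid E] [Module ℝ E] [IsOrderedModule ℝ E] (μ : ExtMeasure X E)

theorem extSMul_le_elemIntegral (φ : MeasureTheory.SimpleFunc X ℝ≥0) {B : Set X}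
    (hB : MeasurableSet B) {r : ℝ≥0} (hr : ∀ x ∈ B, r ≤ φ x) :
    extSMul r (μ B) ≤ μ.elemIntegral φ := by
  rw [μ.apply_eq_sum_inter_preimage φ hB, extSMul_sum]
  refine Finset.sum_le_sum fun q _ => ?_
  rcases (B ∩ φ ⁻¹' {q}).eq_empty_or_nonempty with h | ⟨x, hxB, rfl⟩
  · rw [h, μ.empty, extSMul_zero]
    exact extSMul_nonneg _ (μ.nonneg _)
  · exact extSMul_le_extSMul (hr x hxB) (μ.nonneg _)
      (μ.mono (hB.inter (φ.measurableSet_fiber _)) (φ.measurableSet_fiber _) Set.inter_subset_right)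

theorem elemIntegral_le (φ : MeasureTheory.SimpleFunc X ℝ≥0) {B : Set X}
    (hB : MeasurableSet B) (h1 : ∀ x, φ x ≤ 1) (h0 : ∀ x ∉ B, φ x = 0) :
    μ.elemIntegral φ ≤ μ B := by
  rw [μ.apply_eq_sum_inter_preimage φ hB]
  refine Finset.sum_le_sum fun q hq => ?_
  obtain ⟨x, rfl⟩ := φ.mem_range.1 hq
  rcases eq_or_ne (φ x) 0 with hx | hx
  · rw [hx, extSMul_zero_left]
    exact μ.nonneg _
  · refine (extSMul_le_extSMul (h1 x) (μ.nonneg _) le_rfl).trans ?_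
    rw [extSMul_one]
    refine μ.mono (φ.measurableSet_fiber _) (hB.inter (φ.measurableSet_fiber _)) fun y hy => ⟨?_, hy⟩
    by_contra hyB
    exact hx (((Set.mem_singleton_iff.1 hy).symm).trans (h0 y hyB))

end Integral

/-! ### Measures that represent `π` -/

section Represents

variable {X : Type*} [TopologicalSpace X] [MeasurableSpace X] {E : Type*} [AddCommGroup E]
  [PartialOrder E] [IsOrderedAddMonoid E] [Module ℝ E] [IsOrderedModule ℝ E]
  {μ : ExtMeasure X E} {π : C_c(X, ℝ) →ₚ[ℝ] E}

theorem Represents.hasPosIntegral (h : μ.Represents π) {f : C_c(X, ℝ)} (hf : 0 ≤ f) :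
    μ.HasPosIntegral (fun x => ENNReal.ofReal (f x)) (π f) := by
  obtain ⟨-, -, a, b, ha, ⟨φ, -, hsup, hlub⟩, hab⟩ := h f
  -- The integral `b` of the negative part comes from an unspecified approximating sequence; as `f ≥
  -- 0`, every term of it vanishes, so `b = 0`.
  have hφ : ∀ n x, φ n x = 0 := fun n x => by
    have h1 : (φ n x : ℝ≥0∞) ≤ ⨆ n, (φ n x : ℝ≥0∞) := le_iSup (fun n => (φ n x : ℝ≥0∞)) n
    rw [hsup] at h1
    have h0 : ENNReal.ofReal (-f x) = 0 := ENNReal.ofReal_of_nonpos (neg_nonpos.2 (hf x))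
    simpa [h0] using h1
  have hb : (b : WithTop E) ≤ μ ∅ := by
    refine hlub.2 ?_
    rintro _ ⟨n, rfl⟩
    exact μ.elemIntegral_le (φ n) .empty (fun x => by simp [hφ]) fun x _ => hφ n x
  have hb' : 0 ≤ (b : WithTop E) := by
    refine le_trans ?_ (hlub.1 ⟨0, rfl⟩)
    exact Finset.sum_nonneg fun r _ => extSMul_nonneg _ (μ.nonneg _)
  rw [μ.empty] at hb
  have : b = 0 := by exact_mod_cast le_antisymm hb hb'
  rw [hab, this, sub_zero]
  exact ha

theorem Represents.le_apply_of_tsupport_subset (h : μ.Represents π) {f : C_c(X, ℝ)}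
    (hf : ∀ x, f x ∈ Set.Icc 0 1) {V : Set X} (hV : MeasurableSet V) (hfV : tsupport f ⊆ V) :
    (π f : WithTop E) ≤ μ V := by
  obtain ⟨φ, -, hsup, hlub⟩ := h.hasPosIntegral (f := f) fun x => (hf x).1
  refine hlub.2 ?_
  rintro _ ⟨n, rfl⟩
  have hle : ∀ x, (φ n x : ℝ≥0∞) ≤ ENNReal.ofReal (f x) := fun x => by
    exact (le_iSup (fun n => (φ n x : ℝ≥0∞)) n).trans_eq (hsup x)
  refine μ.elemIntegral_le (φ n) hV (fun x => ?_) fun x hx => ?_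
  · have := (hle x).trans (ENNReal.ofReal_le_one.2 (hf x).2)
    exact_mod_cast this
  · have := hle x
    rw [image_eq_zero_of_notMem_tsupport fun hc => hx (hfV hc)] at this
    simpa using this

/-- The approximants of `f` need not reach `1` on `K`, but for each `r < 1` the sets where they
exceed `r` increase to `K`. This gives `μ K ≤ r⁻¹ • π f`, and `r → 1` is taken under functionals. -/
theorem Represents.apply_le_of_one_le (hE : IsNormalSpace E) (h : μ.Represents π) {f : C_c(X, ℝ)}
    (hf : 0 ≤ f) {K : Set X} (hK : MeasurableSet K) (hfK : ∀ x ∈ K, 1 ≤ f x) :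
    μ K ≤ (π f : WithTop E) := by
  obtain ⟨φ, hmono, hsup, hlub⟩ := h.hasPosIntegral hf
  have key : ∀ r : ℝ≥0, 0 < r → r < 1 → μ K ≤ (((r : ℝ)⁻¹ • π f : E) : WithTop E) := by
    intro r hr0 hr1
    let B : ℕ → Set X := fun n => K ∩ {x | r ≤ φ n x}
    have hBm : ∀ n, MeasurableSet (B n) := fun n =>
      hK.inter (measurableSet_le measurable_const (φ n).measurable)
    have hB : Monotone B := fun m n hmn x hx => ⟨hx.1, le_trans hx.2 (hmono x hmn)⟩
    have hU : ⋃ n, B n = K := by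
      refine subset_antisymm (Set.iUnion_subset fun n => Set.inter_subset_left) fun x hx => ?_
      have : (r : ℝ≥0∞) < ⨆ n, (φ n x : ℝ≥0∞) := by
        rw [hsup]
        refine lt_of_lt_of_le (b := 1) (by exact_mod_cast hr1) ?_
        simpa using hfK x hx
      obtain ⟨n, hn⟩ := lt_iSup_iff.1 this
      exact Set.mem_iUnion.2 ⟨n, hx, by exact_mod_cast hn.le⟩
    have hlubB := μ.isLUB_iUnion hBm hB
    rw [hU] at hlubB
    refine hlubB.2 ?_
    rintro _ ⟨n, rfl⟩
    have hle := (μ.extSMul_le_elemIntegral (φ n) (hBm n) fun x hx => hx.2).trans (hlub.1 ⟨n, rfl⟩)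
    dsimp only
    generalize μ (B n) = b at hle ⊢
    induction b using WithTop.recTopCoe with
    | top => simp [extSMul_top hr0.ne'] at hle
    | coe b =>
      rw [extSMul_coe, WithTop.coe_le_coe] at hle
      rw [WithTop.coe_le_coe]
      exact (le_inv_smul_iff_of_pos (by exact_mod_cast hr0)).2 hle
  have hfin : μ K ≠ ⊤ := ne_top_of_le_ne_top WithTop.coe_ne_top (key (1 / 2) (by simp)
    (NNReal.half_lt_self one_ne_zero))
  lift μ K to E using hfin with k hk
  rw [WithTop.coe_le_coe]
  refine hE.le_of_forall fun ψ _ => ?_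
  by_contra! hlt
  have hB : 0 ≤ ψ (π f) := ψ.map_nonneg (π.map_nonneg hf)
  have hA : 0 < ψ k := hB.trans_lt hlt
  -- The midpoint of `ψ (π f) / ψ k` and `1`: an `r < 1` still large enough that `r * ψ k > ψ (π
  -- f)`.
  have hr0 : 0 < (1 + ψ (π f) / ψ k) / 2 := by positivity
  have hr1 : (1 + ψ (π f) / ψ k) / 2 < 1 := by
    have := (div_lt_one hA).2 hlt
    linarith
  have h1 := WithTop.coe_le_coe.1 (key ⟨_, hr0.le⟩ hr0 hr1)
  have h2 := OrderHomClass.mono ψ ((le_inv_smul_iff_of_pos hr0).1 h1)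
  rw [map_smul, smul_eq_mul] at h2
  have h3 : (1 + ψ (π f) / ψ k) / 2 * ψ k = (ψ k + ψ (π f)) / 2 := by field_simp
  linarith

variable [BorelSpace X]

theorem Represents.isBorel [T2Space X] [LocallyCompactSpace X] (hE : IsNormalSpace E)
    (h : μ.Represents π) : μ.IsBorel := by
  intro K hK
  obtain ⟨f, hf1, hfc, -, hf01⟩ :=
    exists_continuousMap_one_of_isCompact_subset_isOpen hK isOpen_univ (Set.subset_univ K)
  refine ne_top_of_le_ne_top WithTop.coe_ne_top
    (h.apply_le_of_one_le hE (f := ⟨f, hfc⟩) (fun x => (hf01 x).1) hK.measurableSet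
      fun x hx => (hf1 hx).ge)

/-- At an open set, an inner regular measure is determined by the operator that it represents. -/
theorem Represents.isLUB_of_isOpen [T2Space X] [LocallyCompactSpace X] (hE : IsNormalSpace E)
    (h : μ.Represents π) {V : Set X} (hV : IsOpen V) (hreg : μ.InnerRegularAt V) :
    IsLUB {a : WithTop E | ∃ f : C_c(X, ℝ), (∀ x, f x ∈ Set.Icc 0 1) ∧ tsupport f ⊆ V ∧ a = π f}
      (μ V) := by
  constructor
  · rintro _ ⟨f, hf, hfV, rfl⟩
    exact h.le_apply_of_tsupport_subset hf hV.measurableSet hfV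
  · intro b hb
    refine hreg.2 ?_
    rintro _ ⟨K, hK, hKV, rfl⟩
    obtain ⟨f, hf1, hfc, hfV, hf01⟩ :=
      exists_continuousMap_one_of_isCompact_subset_isOpen hK hV hKV
    exact (h.apply_le_of_one_le hE (f := ⟨f, hfc⟩) (fun x => (hf01 x).1) hK.measurableSet
      fun x hx => (hf1 hx).ge).trans (hb ⟨⟨f, hfc⟩, hf01, hfV, rfl⟩)

end Represents

end ExtMeasure

open MeasureTheory TopologicalSpace

/-! ### The weakly inner regular modification of a scalar measure -/

section CompactlyInner

variable {X : Type*} [TopologicalSpace X] [MeasurableSpace X]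

/-- The supremum of the measures of the intersections with compact sets. -/
noncomputable def compactlyInner (m : Measure X) (D : Set X) : ℝ≥0∞ :=
  ⨆ K : Compacts X, m (D ∩ K)

theorem compactlyInner_of_subset (m : Measure X) {D K : Set X} (hK : IsCompact K) (h : D ⊆ K) :
    compactlyInner m D = m D := by
  refine le_antisymm (iSup_le fun K => measure_mono Set.inter_subset_left) ?_
  refine le_iSup_of_le ⟨K, hK⟩ ?_
  simp [Set.inter_eq_self_of_subset_left h]

theorem compactlyInner_mono (m : Measure X) {A B : Set X} (h : A ⊆ B) :
    compactlyInner m A ≤ compactlyInner m B :=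
  iSup_mono fun _ => measure_mono (Set.inter_subset_inter_left _ h)

/-- The suprema over `K` and `N` commute, and the one over `K` passes through finite sums because
compact sets are directed. -/
theorem compactlyInner_iUnion [T2Space X] [BorelSpace X] (m : Measure X) {s : ℕ → Set X}
    (hs : ∀ n, MeasurableSet (s n)) (hd : Pairwise (fun m n => Disjoint (s m) (s n))) :
    compactlyInner m (⋃ n, s n) = ⨆ N : ℕ, ∑ n ∈ Finset.range (N + 1), compactlyInner m (s n) := by
  have h1 : ∀ K : Compacts X,
      m ((⋃ n, s n) ∩ K) = ⨆ N : ℕ, ∑ n ∈ Finset.range (N + 1), m (s n ∩ K) := fun K => by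
    rw [Set.iUnion_inter, measure_iUnion
      (fun i j hij => (hd hij).mono Set.inter_subset_left Set.inter_subset_left)
      (fun n => (hs n).inter K.isCompact.measurableSet)]
    exact ENNReal.tsum_eq_iSup_nat' (Filter.tendsto_add_atTop_nat 1)
  simp only [compactlyInner, h1]
  rw [iSup_comm]
  refine iSup_congr fun N => (ENNReal.finsetSum_iSup_of_monotone fun n K L hKL => ?_).symm
  exact measure_mono (Set.inter_subset_inter_right _ hKL)

end CompactlyInner

variable {X : Type*} [TopologicalSpace X] [T2Space X] [LocallyCompactSpace X]
  [MeasurableSpace X] [BorelSpace X]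
  {E : Type*} [AddCommGroup E] [PartialOrder E] [Module ℝ E] (π : C_c(X, ℝ) →ₚ[ℝ] E)

/-- The Riesz measures of the compositions of `π` with the positive functionals on `E`. -/
noncomputable abbrev functionalMeasure (φ : E →ₚ[ℝ] ℝ) : Measure X :=
  RealRMK.rieszMeasure (φ.comp π)

/-! ### Existence of the values at relatively compact sets -/

section LocalValues

variable [IsOrderedAddMonoid E] {π}

/-- The element is the supremum of the `π f`, directed through `f ⊔ g` and bounded by `π g` for a
`g` equal to `1` on `closure V`. Inner regularity of the Riesz measure at `V` and Urysohn functions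
identify its values. -/
theorem exists_hasValue_of_isOpen (hE : IsMonotoneComplete E) {V : Set X} (hV : IsOpen V)
    (hVc : IsCompact (closure V)) : ∃ e : E, HasValue e fun φ => functionalMeasure π φ V := by
  let ι := {f : C_c(X, ℝ) // (∀ x, f x ∈ Set.Icc 0 1) ∧ tsupport f ⊆ V}
  have : Nonempty ι := ⟨⟨0, by simp, by simp [tsupport]⟩⟩
  have hdir : Directed (· ≤ ·) fun f : ι => π f.1 := by
    rintro ⟨f, hf, hfV⟩ ⟨g, hg, hgV⟩
    refine ⟨⟨f ⊔ g, fun x => ⟨le_sup_of_le_left (hf x).1, sup_le (hf x).2 (hg x).2⟩, ?_⟩,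
      OrderHomClass.mono π le_sup_left, OrderHomClass.mono π le_sup_right⟩
    refine subset_trans ?_ (Set.union_subset hfV hgV)
    rw [tsupport, tsupport, tsupport, ← closure_union]
    refine closure_mono fun x hx => ?_
    by_contra hc
    simp only [Set.mem_union, Function.mem_support, not_or, not_not] at hc
    exact hx (by simp [hc.1, hc.2])
  obtain ⟨g, hg1, hgc, -, hg01⟩ :=
    exists_continuousMap_one_of_isCompact_subset_isOpen hVc isOpen_univ (Set.subset_univ _)
  have hbdd : BddAbove (Set.range fun f : ι => π f.1) := by
    refine ⟨π ⟨g, hgc⟩, ?_⟩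
    rintro _ ⟨⟨f, hf, hfV⟩, rfl⟩
    refine OrderHomClass.mono π fun x => ?_
    by_cases hx : x ∈ closure V
    · exact (hf x).2.trans (hg1 hx).ge
    · have : f x = 0 := image_eq_zero_of_notMem_tsupport fun hc => hx (subset_closure (hfV hc))
      exact this.trans_le (hg01 x).1
  obtain ⟨e, he⟩ := HasValue.exists_iSup (d := fun (f : ι) φ => ENNReal.ofReal (φ (π f.1))) hE
    (fun f => ⟨π.map_nonneg fun x => (f.2.1 x).1, fun φ _ => rfl⟩) hdir hbdd
  refine ⟨e, he.congr fun φ _ => le_antisymm (iSup_le fun f => ?_) ?_⟩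
  · exact RealRMK.le_rieszMeasure_tsupport_subset (φ.comp π) f.2.1 f.2.2
  · rw [hV.measure_eq_iSup_isCompact]
    refine iSup₂_le fun K hKV => iSup_le fun hK => ?_
    obtain ⟨f, hf1, hfc, hfV, hf01⟩ :=
      exists_continuousMap_one_of_isCompact_subset_isOpen hK hV hKV
    refine le_trans ?_ (le_iSup (fun f : ι => ENNReal.ofReal (φ (π f.1))) ⟨⟨f, hfc⟩, hf01, hfV⟩)
    exact RealRMK.rieszMeasure_le_of_eq_one (φ.comp π) (f := ⟨f, hfc⟩) (fun x => (hf01 x).1) hK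
      fun x hx => hf1 hx

theorem exists_hasValue_of_subset_isCompact (hE : IsMonotoneComplete E) (hn : IsNormalSpace E)
    {D K : Set X} (hK : IsCompact K) (hD : MeasurableSet D) (hDK : D ⊆ K) :
    ∃ e : E, HasValue e fun φ => functionalMeasure π φ D := by
  obtain ⟨V, hV, hKV, hVc⟩ := exists_isOpen_superset_and_isCompact_closure hK
  have hVm := hV.measurableSet
  -- Intersecting with `V` makes the claim meaningful for all Borel `D`, as the induction requires.
  suffices ∃ e : E, HasValue e fun φ => functionalMeasure π φ (V ∩ D) by
    rwa [Set.inter_eq_self_of_subset_right (hDK.trans hKV)] at this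
  clear hDK
  obtain ⟨u, hu⟩ := exists_hasValue_of_isOpen (π := π) hE hV hVc
  induction D, hD using MeasurableSpace.induction_on_inter (BorelSpace.measurable_eq (α := X))
    isPiSystem_isOpen with
  | empty => exact ⟨0, by simpa using HasValue.zero⟩
  | basic t ht =>
    exact exists_hasValue_of_isOpen hE (hV.inter ht)
      (hVc.of_isClosed_subset isClosed_closure (closure_mono Set.inter_subset_left))
  | compl t ht ih =>
    obtain ⟨e, he⟩ := ih
    refine ⟨u - e, hu.sub hn he fun φ _ => ?_⟩
    rw [← Set.sdiff_eq_compl_inter.trans (Set.inter_comm _ _), add_comm,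
      measure_inter_add_sdiff V ht]
  | iUnion f hd hf ih =>
    choose e he using ih
    have hd' : Pairwise (fun m n => Disjoint (V ∩ f m) (V ∩ f n)) := fun m n hmn =>
      (hd hmn).mono Set.inter_subset_right Set.inter_subset_right
    have hsum : ∀ φ, ⨆ N : ℕ, ∑ n ∈ Finset.range N, functionalMeasure π φ (V ∩ f n) =
        functionalMeasure π φ (V ∩ ⋃ n, f n) := fun φ => by
      rw [Set.inter_iUnion, measure_iUnion hd' fun n => hVm.inter (hf n), ENNReal.tsum_eq_iSup_nat]
    have hpart : ∀ N : ℕ, HasValue (∑ n ∈ Finset.range N, e n)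
        fun φ => ∑ n ∈ Finset.range N, functionalMeasure π φ (V ∩ f n) :=
      fun N => HasValue.sum fun n _ => he n
    have hbdd : BddAbove (Set.range fun N : ℕ => ∑ n ∈ Finset.range N, e n) := by
      refine ⟨u, ?_⟩
      rintro _ ⟨N, rfl⟩
      refine (hpart N).le hn hu fun φ _ => ?_
      refine (le_iSup (fun N => ∑ n ∈ Finset.range N, functionalMeasure π φ (V ∩ f n)) N).trans ?_
      rw [hsum]
      exact measure_mono Set.inter_subset_left
    obtain ⟨x, hx⟩ := HasValue.exists_iSup hE hpart
      (Monotone.directed_le fun M N hMN => Finset.sum_le_sum_of_subset_of_nonneg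
        (Finset.range_mono hMN) fun n _ _ => (he n).1) hbdd
    exact ⟨x, hx.congr fun φ _ => hsum φ⟩

end LocalValues

/-- The values that the order continuous functionals have to take at the measure of `D`. -/
noncomputable def functionalValue (D : Set X) (φ : E →ₚ[ℝ] ℝ) : ℝ≥0∞ :=
  compactlyInner (functionalMeasure π φ) D

/-! ### From local values to the measure -/

section Values

variable {π}

theorem functionalValue_of_subset {D K : Set X} (hK : IsCompact K) (h : D ⊆ K) (φ : E →ₚ[ℝ] ℝ) :
    functionalValue π D φ = functionalMeasure π φ D :=
  compactlyInner_of_subset _ hK h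

theorem functionalValue_inter_compact (D : Set X) (K : Compacts X) (φ : E →ₚ[ℝ] ℝ) :
    functionalValue π (D ∩ K) φ = functionalMeasure π φ (D ∩ K) :=
  functionalValue_of_subset K.isCompact Set.inter_subset_right φ

variable [IsOrderedAddMonoid E]

theorem exists_hasValue_functionalValue_of_subset (hE : IsMonotoneComplete E)
    (hn : IsNormalSpace E) {D K : Set X} (hK : IsCompact K) (hD : MeasurableSet D) (hDK : D ⊆ K) :
    ∃ e : E, HasValue e (functionalValue π D) := by
  obtain ⟨e, he⟩ := exists_hasValue_of_subset_isCompact (π := π) hE hn hK hD hDK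
  exact ⟨e, he.congr fun φ _ => (functionalValue_of_subset hK hDK φ).symm⟩

/-- Contrapositively, where the measure is `∞`, the values at the sets `D ∩ K` have no upper bound
in `E`; this makes `∞` their supremum. -/
theorem exists_hasValue_of_forall_le (hE : IsMonotoneComplete E) (hn : IsNormalSpace E)
    {D : Set X} (hD : MeasurableSet D) {b : E}
    (hb : ∀ K : Compacts X, ∀ e : E, HasValue e (functionalValue π (D ∩ K)) → e ≤ b) :
    ∃ e : E, HasValue e (functionalValue π D) := by
  choose v hv using fun K : Compacts X => exists_hasValue_functionalValue_of_subset (π := π) hE hn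
    K.isCompact (hD.inter K.isCompact.measurableSet) Set.inter_subset_right
  obtain ⟨e, he⟩ := HasValue.exists_iSup hE hv
    (Monotone.directed_le fun K L hKL => (hv K).le hn (hv L) fun φ _ =>
      compactlyInner_mono _ (Set.inter_subset_inter_right _ hKL))
    ⟨b, by rintro _ ⟨K, rfl⟩; exact hb K _ (hv K)⟩
  exact ⟨e, he.congr fun φ _ => iSup_congr fun K => functionalValue_inter_compact D K φ⟩

theorem exists_hasValue_mono (hE : IsMonotoneComplete E) (hn : IsNormalSpace E)
    {D D' : Set X} (hD : MeasurableSet D) (hDD : D ⊆ D') {e' : E}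
    (he' : HasValue e' (functionalValue π D')) : ∃ e : E, HasValue e (functionalValue π D) :=
  exists_hasValue_of_forall_le hE hn hD fun _ _ he => he.le hn he' fun _ _ =>
    compactlyInner_mono _ (Set.inter_subset_left.trans hDD)

end Values

open Classical in
/-- The measure of `D`, the element of `E` at which the order continuous functionals take the
required values if there is one, and `∞` otherwise. -/
noncomputable def rieszValue (D : Set X) : WithTop E :=
  if MeasurableSet D then
    if h : ∃ e : E, HasValue e (functionalValue π D) then (h.choose : WithTop E) else ⊤
  else 0

section Measure

variable {π}

theorem rieszValue_eq_coe [IsOrderedAddMonoid E] (hn : IsNormalSpace E) {D : Set X}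
    (hD : MeasurableSet D) {e : E} (he : HasValue e (functionalValue π D)) :
    rieszValue π D = e := by
  have h : ∃ e : E, HasValue e (functionalValue π D) := ⟨e, he⟩
  rw [rieszValue, if_pos hD, dif_pos h, h.choose_spec.unique hn he]

theorem rieszValue_eq_top {D : Set X} (hD : MeasurableSet D)
    (h : ¬ ∃ e : E, HasValue e (functionalValue π D)) : rieszValue π D = ⊤ := by
  rw [rieszValue, if_pos hD, dif_neg h]

variable [IsOrderedAddMonoid E]

theorem rieszValue_sigma_additive (hE : IsMonotoneComplete E) (hn : IsNormalSpace E)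
    {s : ℕ → Set X} (hs : ∀ n, MeasurableSet (s n))
    (hd : Pairwise (fun m n => Disjoint (s m) (s n))) :
    IsLUB (Set.range fun N : ℕ => ∑ n ∈ Finset.range (N + 1), rieszValue π (s n))
      (rieszValue π (⋃ n, s n)) := by
  have hU := MeasurableSet.iUnion hs
  by_cases hrep : ∀ n, ∃ e : E, HasValue e (functionalValue π (s n))
  · choose e he using hrep
    have hpart : ∀ N : ℕ, HasValue (∑ n ∈ Finset.range (N + 1), e n)
        fun φ => ∑ n ∈ Finset.range (N + 1), functionalValue π (s n) φ :=
      fun N => HasValue.sum fun n _ => he n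
    have hsum : ∀ φ, functionalValue π (⋃ n, s n) φ =
        ⨆ N : ℕ, ∑ n ∈ Finset.range (N + 1), functionalValue π (s n) φ := fun φ =>
      compactlyInner_iUnion _ hs hd
    have hcoe : ∀ N : ℕ, ∑ n ∈ Finset.range (N + 1), rieszValue π (s n) =
        ((∑ n ∈ Finset.range (N + 1), e n : E) : WithTop E) := fun N => by
      rw [WithTop.coe_sum]
      exact Finset.sum_congr rfl fun n _ => rieszValue_eq_coe hn (hs n) (he n)
    simp only [hcoe]
    by_cases hx : ∃ x : E, HasValue x (functionalValue π (⋃ n, s n))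
    · obtain ⟨x, hx⟩ := hx
      rw [rieszValue_eq_coe hn hU hx]
      exact HasValue.isLUB hn hpart (hx.congr fun φ _ => hsum φ)
    · rw [rieszValue_eq_top hU hx]
      refine ⟨fun _ _ => le_top, fun b hb => ?_⟩
      induction b using WithTop.recTopCoe with
      | top => exact le_rfl
      | coe b =>
        obtain ⟨x, hx'⟩ := HasValue.exists_iSup hE hpart
          (Monotone.directed_le fun M N hMN => Finset.sum_le_sum_of_subset_of_nonneg
            (Finset.range_mono (Nat.succ_le_succ hMN)) fun n _ _ => (he n).1)
          ⟨b, by rintro _ ⟨N, rfl⟩; exact WithTop.coe_le_coe.1 (hb ⟨N, rfl⟩)⟩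
        exact (hx ⟨x, hx'.congr fun φ _ => (hsum φ).symm⟩).elim
  -- Some term is `∞`. The union is then `∞` as well, since a value at the union would bound that
  -- term.
  · push Not at hrep
    obtain ⟨n, hn'⟩ := hrep
    rw [rieszValue_eq_top hU fun ⟨x, hx⟩ => by
      obtain ⟨e, he⟩ := exists_hasValue_mono hE hn (hs n) (Set.subset_iUnion s n) hx
      exact hn' e he]
    refine IsGreatest.isLUB ⟨⟨n, ?_⟩, fun _ _ => le_top⟩
    refine WithTop.sum_eq_top.2 ⟨n, by simp, ?_⟩
    exact rieszValue_eq_top (hs n) fun ⟨e, he⟩ => hn' e he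

end Measure

variable [IsOrderedAddMonoid E]

/-- The measure with values in `E ∪ {∞}` that the order continuous functionals map to the Riesz
measures. -/
noncomputable def rieszExtMeasure (hE : IsMonotoneComplete E) (hn : IsNormalSpace E) :
    ExtMeasure X E where
  toFun := rieszValue π
  nonneg D := by
    unfold rieszValue
    split_ifs with hD h
    · exact WithTop.coe_le_coe.2 h.choose_spec.1
    · exact le_top
    · exact le_rfl
  empty := rieszValue_eq_coe hn .empty <| HasValue.zero.congr fun φ _ => by
    simp [functionalValue, compactlyInner]
  not_measurable D hD := if_neg hD
  sigma_additive s hs hd := rieszValue_sigma_additive hE hn hs hd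

end OrderedMeasure

namespace OrderedMeasure

open MeasureTheory TopologicalSpace

/-! ### Regularity of the constructed measure and representation of `π` -/

section RieszExtMeasure

variable {X : Type*} [TopologicalSpace X] [T2Space X] [LocallyCompactSpace X]
  [MeasurableSpace X] [BorelSpace X]
  {E : Type*} [AddCommGroup E] [PartialOrder E] [Module ℝ E] [IsOrderedAddMonoid E]
  (π : C_c(X, ℝ) →ₚ[ℝ] E) (hE : IsMonotoneComplete E) (hn : IsNormalSpace E)

theorem exists_rieszExtMeasure_eq {D K : Set X} (hK : IsCompact K) (hD : MeasurableSet D)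
    (hDK : D ⊆ K) : ∃ e : E, rieszExtMeasure π hE hn D = e ∧
      HasValue e fun φ => functionalMeasure π φ D := by
  obtain ⟨e, he⟩ := exists_hasValue_functionalValue_of_subset (π := π) hE hn hK hD hDK
  exact ⟨e, rieszValue_eq_coe hn hD he, he.congr fun φ _ => functionalValue_of_subset hK hDK φ⟩

theorem rieszExtMeasure_weaklyInnerRegularAt {D : Set X} (hD : MeasurableSet D) :
    (rieszExtMeasure π hE hn).WeaklyInnerRegularAt D := by
  choose v hvμ hv using fun K : Compacts X => exists_rieszExtMeasure_eq π hE hn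
    K.isCompact (hD.inter K.isCompact.measurableSet) Set.inter_subset_right
  have hset : {a | ∃ K, IsCompact K ∧ a = rieszExtMeasure π hE hn (D ∩ K)} =
      Set.range fun K => (v K : WithTop E) := by
    ext a
    constructor
    · rintro ⟨K, hK, rfl⟩
      exact ⟨⟨K, hK⟩, (hvμ ⟨K, hK⟩).symm⟩
    · rintro ⟨K, rfl⟩
      exact ⟨K, K.isCompact, (hvμ K).symm⟩
  rw [ExtMeasure.WeaklyInnerRegularAt, hset]
  by_cases h : ∃ e : E, HasValue e (functionalValue π D)
  · obtain ⟨e, he⟩ := h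
    rw [show rieszExtMeasure π hE hn D = e from rieszValue_eq_coe hn hD he]
    exact HasValue.isLUB hn hv he
  · rw [show rieszExtMeasure π hE hn D = ⊤ from rieszValue_eq_top hD h]
    refine ⟨fun _ _ => le_top, fun b hb => ?_⟩
    induction b using WithTop.recTopCoe with
    | top => exact le_rfl
    | coe b =>
      refine (h (exists_hasValue_of_forall_le hE hn hD (b := b) fun K e he => ?_)).elim
      refine le_trans (le_of_eq ?_) (WithTop.coe_le_coe.1 (hb ⟨K, rfl⟩))
      exact he.unique hn ((hv K).congr fun φ _ => (functionalValue_inter_compact D K φ).symm)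

theorem rieszExtMeasure_innerRegularAt_of_isCompact_closure {V : Set X} (hV : IsOpen V)
    (hVc : IsCompact (closure V)) : (rieszExtMeasure π hE hn).InnerRegularAt V := by
  obtain ⟨e, heμ, he⟩ := exists_rieszExtMeasure_eq π hE hn hVc hV.measurableSet subset_closure
  let ι := {K : Set X // IsCompact K ∧ K ⊆ V}
  have : Nonempty ι := ⟨⟨∅, isCompact_empty, Set.empty_subset V⟩⟩
  choose v hvμ hv using fun K : ι =>
    exists_rieszExtMeasure_eq π hE hn K.2.1 K.2.1.measurableSet subset_rfl
  have hset : {a | ∃ K, IsCompact K ∧ K ⊆ V ∧ a = rieszExtMeasure π hE hn K} =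
      Set.range fun K => (v K : WithTop E) := by
    ext a
    constructor
    · rintro ⟨K, hK, hKV, rfl⟩
      exact ⟨⟨K, hK, hKV⟩, (hvμ ⟨K, hK, hKV⟩).symm⟩
    · rintro ⟨K, rfl⟩
      exact ⟨K.1, K.2.1, K.2.2, (hvμ K).symm⟩
  rw [ExtMeasure.InnerRegularAt, hset, heμ]
  refine HasValue.isLUB hn hv (he.congr fun φ _ => ?_)
  rw [hV.measure_eq_iSup_isCompact]
  refine le_antisymm (iSup₂_le fun K hKV => iSup_le fun hK => ?_) (iSup_le fun K => ?_)
  · exact le_iSup (fun K : ι => functionalMeasure π φ K.1) ⟨K, hK, hKV⟩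
  · exact le_iSup₂_of_le K.1 K.2.2 (le_iSup_of_le K.2.1 le_rfl)

theorem rieszExtMeasure_innerRegularAt {V : Set X} (hV : IsOpen V) :
    (rieszExtMeasure π hE hn).InnerRegularAt V := by
  constructor
  · rintro _ ⟨K, hK, hKV, rfl⟩
    exact ExtMeasure.mono _ hK.measurableSet hV.measurableSet hKV
  · intro b hb
    refine (rieszExtMeasure_weaklyInnerRegularAt π hE hn hV.measurableSet).2 ?_
    rintro _ ⟨K, hK, rfl⟩
    obtain ⟨U, hU, hKU, hUc⟩ := exists_isOpen_superset_and_isCompact_closure hK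
    refine (ExtMeasure.mono _ (hV.measurableSet.inter hK.measurableSet)
      (hV.inter hU).measurableSet (Set.inter_subset_inter_right V hKU)).trans ?_
    refine (rieszExtMeasure_innerRegularAt_of_isCompact_closure π hE hn (hV.inter hU)
      (hUc.of_isClosed_subset isClosed_closure (closure_mono Set.inter_subset_right))).2 ?_
    rintro _ ⟨C, hC, hCV, rfl⟩
    exact hb ⟨C, hC, hCV.trans Set.inter_subset_left, rfl⟩

theorem rieszExtMeasure_isBorel : (rieszExtMeasure π hE hn).IsBorel := fun K hK => by
  obtain ⟨e, he, -⟩ := exists_rieszExtMeasure_eq π hE hn hK hK.measurableSet subset_rfl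
  simp [he]

theorem rieszExtMeasure_isQuasiRegularBorel : (rieszExtMeasure π hE hn).IsQuasiRegularBorel :=
  ⟨rieszExtMeasure_isBorel π hE hn, fun _ hV => rieszExtMeasure_innerRegularAt π hE hn hV,
    fun _ hD => rieszExtMeasure_weaklyInnerRegularAt π hE hn hD⟩

/-- Keeping `V` inside `U` makes all values finite, so outer regularity of the scalar Riesz measures
transfers; it is also the form needed for the subspace `U`. -/
theorem rieszExtMeasure_isGLB_isOpen {U D : Set X} (hU : IsOpen U) (hUc : IsCompact (closure U))
    (hD : MeasurableSet D) (hDU : D ⊆ U) :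
    IsGLB {a | ∃ V, IsOpen V ∧ D ⊆ V ∧ V ⊆ U ∧ a = rieszExtMeasure π hE hn V}
      (rieszExtMeasure π hE hn D) := by
  obtain ⟨e, heμ, he⟩ := exists_rieszExtMeasure_eq π hE hn hUc hD (hDU.trans subset_closure)
  let ι := {V : Set X // IsOpen V ∧ D ⊆ V ∧ V ⊆ U}
  have : Nonempty ι := ⟨⟨U, hU, hDU, subset_rfl⟩⟩
  choose v hvμ hv using fun V : ι =>
    exists_rieszExtMeasure_eq π hE hn hUc V.2.1.measurableSet (V.2.2.2.trans subset_closure)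
  have hset : {a | ∃ V, IsOpen V ∧ D ⊆ V ∧ V ⊆ U ∧ a = rieszExtMeasure π hE hn V} =
      Set.range fun V => (v V : WithTop E) := by
    ext a
    constructor
    · rintro ⟨V, hV, hDV, hVU, rfl⟩
      exact ⟨⟨V, hV, hDV, hVU⟩, (hvμ ⟨V, hV, hDV, hVU⟩).symm⟩
    · rintro ⟨V, rfl⟩
      exact ⟨V.1, V.2.1, V.2.2.1, V.2.2.2, (hvμ V).symm⟩
  rw [hset, heμ]
  refine HasValue.isGLB hn hv (he.congr fun φ _ => le_antisymm (le_iInf fun V => ?_) ?_)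
  · exact measure_mono V.2.2.1
  · rw [D.measure_eq_iInf_isOpen]
    refine le_iInf₂ fun V hDV => le_iInf fun hV => ?_
    exact (iInf_le (fun V : ι => functionalMeasure π φ V.1)
      ⟨V ∩ U, hV.inter hU, Set.subset_inter hDV hDU, Set.inter_subset_right⟩).trans
      (measure_mono Set.inter_subset_left)

theorem rieszExtMeasure_isLocallyRegularBorel :
    (rieszExtMeasure π hE hn).IsLocallyRegularBorel := by
  intro U hU hUc
  have hval : ∀ {s : Set U}, MeasurableSet s →
      (rieszExtMeasure π hE hn).restrict U hU.measurableSet s =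
        rieszExtMeasure π hE hn (Subtype.val '' s) := fun hs => if_pos hs
  refine ⟨fun K hK => ?_, fun V hV => ?_, fun D hD => ?_⟩
  · rw [hval hK.measurableSet]
    exact rieszExtMeasure_isBorel π hE hn _ (hK.image continuous_subtype_val)
  · have h := rieszExtMeasure_innerRegularAt π hE hn (hU.isOpenMap_subtype_val V hV)
    rw [ExtMeasure.InnerRegularAt] at h
    rw [ExtMeasure.InnerRegularAt, hval hV.measurableSet]
    convert h using 1
    ext a
    constructor
    · rintro ⟨K, hK, hKV, rfl⟩
      exact ⟨_, hK.image continuous_subtype_val, Set.image_mono hKV, hval hK.measurableSet⟩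
    · rintro ⟨K, hK, hKV, rfl⟩
      have himg : Subtype.val '' (Subtype.val ⁻¹' K : Set U) = K := by
        rw [Subtype.image_preimage_coe]
        exact Set.inter_eq_right.2 (hKV.trans (Subtype.coe_image_subset U V))
      have hK' : IsCompact (Subtype.val ⁻¹' K : Set U) := by
        rwa [Subtype.isCompact_iff, himg]
      refine ⟨_, hK', ?_, ?_⟩
      · exact (Set.preimage_mono hKV).trans (Set.preimage_image_eq V Subtype.val_injective).le
      · rw [hval hK'.measurableSet, himg]
  · have h := rieszExtMeasure_isGLB_isOpen π hE hn hU hUc (hU.measurableSet.subtype_image hD)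
      (Subtype.coe_image_subset U D)
    rw [ExtMeasure.OuterRegularAt, hval hD]
    convert h using 1
    ext a
    constructor
    · rintro ⟨V, hV, hDV, rfl⟩
      exact ⟨_, hU.isOpenMap_subtype_val V hV, Set.image_mono hDV, Subtype.coe_image_subset U V,
        hval hV.measurableSet⟩
    · rintro ⟨V, hV, hDV, hVU, rfl⟩
      have hV' : IsOpen (Subtype.val ⁻¹' V : Set U) := hV.preimage continuous_subtype_val
      refine ⟨_, hV', Set.image_subset_iff.1 hDV, ?_⟩
      rw [hval hV'.measurableSet, Subtype.image_preimage_coe, Set.inter_eq_right.2 hVU]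

variable [IsOrderedModule ℝ E]

theorem rieszExtMeasure_hasPosIntegral {f : C_c(X, ℝ)} (hf : 0 ≤ f) :
    (rieszExtMeasure π hE hn).HasPosIntegral (fun x => ENNReal.ofReal (f x)) (π f) := by
  set g : X → ℝ≥0∞ := fun x => ENNReal.ofReal (f x) with hg
  have hgm : Measurable g := f.continuous.measurable.ennreal_ofReal
  let ψ : ℕ → SimpleFunc X ℝ≥0 := fun n => (SimpleFunc.eapprox g n).map ENNReal.toNNReal
  have hψ : ∀ n x, (ψ n x : ℝ≥0∞) = SimpleFunc.eapprox g n x := fun n x => by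
    simp only [ψ, SimpleFunc.map_apply]
    exact ENNReal.coe_toNNReal (SimpleFunc.eapprox_lt_top g n x).ne
  have hle : ∀ n x, (ψ n x : ℝ≥0∞) ≤ g x := fun n x => by
    rw [hψ, ← SimpleFunc.iSup_eapprox_apply hgm x]
    exact le_iSup (fun n => SimpleFunc.eapprox g n x) n
  have hval : ∀ n r, ∃ e : E, ExtMeasure.extSMul r (rieszExtMeasure π hE hn (ψ n ⁻¹' {r})) = e ∧
      HasValue e fun φ => r * functionalMeasure π φ (ψ n ⁻¹' {r}) := by
    intro n r
    -- The level set of `0` may have measure `∞`, but `0 • ∞ = 0`; the other level sets lie in the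
    -- compact support of `f`.
    rcases eq_or_ne r 0 with rfl | hr
    · exact ⟨0, by simp, by simpa using HasValue.zero⟩
    · obtain ⟨e, heμ, he⟩ := exists_rieszExtMeasure_eq π hE hn (D := ψ n ⁻¹' {r})
        f.hasCompactSupport ((ψ n).measurableSet_fiber r) fun x hx => by
          by_contra hc
          have h0 := hle n x
          rw [Set.mem_singleton_iff.1 hx, hg] at h0
          simp only [image_eq_zero_of_notMem_tsupport hc, ENNReal.ofReal_zero] at h0
          exact hr (by simpa using h0)
      exact ⟨(r : ℝ) • e, by rw [heμ, ExtMeasure.extSMul_coe], he.smul r⟩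
  choose e heμ he using hval
  have hint : ∀ n, (rieszExtMeasure π hE hn).elemIntegral (ψ n) =
      ((∑ r ∈ (ψ n).range, e n r : E) : WithTop E) := fun n => by
    rw [WithTop.coe_sum]
    exact Finset.sum_congr rfl fun r _ => heμ n r
  refine ⟨ψ, fun x m n hmn => ?_, fun x => ?_, ?_⟩
  · exact ENNReal.toNNReal_mono (SimpleFunc.eapprox_lt_top g n x).ne
      (SimpleFunc.monotone_eapprox g hmn x)
  · simp only [hψ]
    exact SimpleFunc.iSup_eapprox_apply hgm x
  · simp only [hint]
    refine HasValue.isLUB hn (fun n => HasValue.sum fun r _ => he n r)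
      ⟨π.map_nonneg hf, fun φ _ => ?_⟩
    have hlin : ∀ n, ∑ r ∈ (ψ n).range, r * functionalMeasure π φ (ψ n ⁻¹' {r}) =
        (SimpleFunc.eapprox g n).lintegral (functionalMeasure π φ) := fun n => by
      rw [← SimpleFunc.map_lintegral]
      congr 1
      ext x
      exact hψ n x
    simp only [hlin]
    rw [← lintegral_eq_iSup_eapprox_lintegral hgm, hg, ← ofReal_integral_eq_lintegral_ofReal (f := f)
      (f.continuous.integrable_of_hasCompactSupport f.hasCompactSupport)
      (Filter.Eventually.of_forall hf), RealRMK.integral_rieszMeasure]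
    rfl

theorem rieszExtMeasure_represents : (rieszExtMeasure π hE hn).Represents π := by
  intro f
  refine ⟨f.continuous.measurable, ⟨π (f ⊔ -f), ?_⟩, π (f ⊔ 0), π (-f ⊔ 0), ?_, ?_, ?_⟩
  · exact rieszExtMeasure_hasPosIntegral π hE hn (f := f ⊔ -f) fun x => abs_nonneg (f x)
  · simpa using rieszExtMeasure_hasPosIntegral π hE hn (f := f ⊔ 0) le_sup_right
  · simpa using rieszExtMeasure_hasPosIntegral π hE hn (f := -f ⊔ 0) le_sup_right
  · rw [← map_sub]
    congr 1
    ext x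
    exact (max_zero_sub_max_neg_zero_eq_self (f x)).symm

end RieszExtMeasure

/-! ### Uniqueness and comparison with regular measures -/

namespace ExtMeasure

variable {X : Type*} [TopologicalSpace X] [T2Space X] [MeasurableSpace X] [BorelSpace X]
  {E : Type*} [AddCommGroup E] [PartialOrder E] {μ : ExtMeasure X E}

theorem IsLocallyRegularBorel.innerRegularAt (h : μ.IsLocallyRegularBorel) {U : Set X}
    (hU : IsOpen U) (hUc : IsCompact (closure U)) : μ.InnerRegularAt U := by
  -- The whole subspace is open in itself, and its compact subsets are the compact subsets of `X`
  -- contained in `U`.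
  have hreg := (h U hU hUc).innerRegular Set.univ isOpen_univ
  have hval : ∀ {s : Set U}, MeasurableSet s →
      μ.restrict U hU.measurableSet s = μ (Subtype.val '' s) := fun hs => if_pos hs
  rw [InnerRegularAt, hval .univ, Set.image_univ, Subtype.range_coe] at hreg
  rw [InnerRegularAt]
  convert hreg using 1
  ext a
  constructor
  · rintro ⟨K, hK, hKU, rfl⟩
    have himg : Subtype.val '' (Subtype.val ⁻¹' K : Set U) = K := by
      rw [Subtype.image_preimage_coe]
      exact Set.inter_eq_right.2 hKU
    have hK' : IsCompact (Subtype.val ⁻¹' K : Set U) := by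
      rwa [Subtype.isCompact_iff, himg]
    exact ⟨_, hK', Set.subset_univ _, by rw [hval hK'.measurableSet, himg]⟩
  · rintro ⟨K, hK, -, rfl⟩
    exact ⟨_, hK.image continuous_subtype_val, Subtype.coe_image_subset U K,
      hval hK.measurableSet⟩

variable [LocallyCompactSpace X] [IsOrderedAddMonoid E] [Module ℝ E] [IsOrderedModule ℝ E]
  {ν : ExtMeasure X E} {π : C_c(X, ℝ) →ₚ[ℝ] E}

theorem Represents.eq_of_isOpen (hn : IsNormalSpace E) (hμ : μ.Represents π)
    (hν : ν.Represents π) {V : Set X} (hV : IsOpen V) (hμV : μ.InnerRegularAt V)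
    (hνV : ν.InnerRegularAt V) : μ V = ν V :=
  (hμ.isLUB_of_isOpen hn hV hμV).unique (hν.isLUB_of_isOpen hn hV hνV)

theorem Represents.eq_of_isLocallyRegularBorel (hn : IsNormalSpace E) (hμ : μ.Represents π)
    (hν : ν.Represents π) (hμl : μ.IsLocallyRegularBorel) (hνl : ν.IsLocallyRegularBorel)
    (hμw : ∀ D, MeasurableSet D → μ.WeaklyInnerRegularAt D)
    (hνw : ∀ D, MeasurableSet D → ν.WeaklyInnerRegularAt D) : μ = ν := by
  refine ext_of_measurable fun D hD => ?_
  have hK : ∀ K, IsCompact K → μ (D ∩ K) = ν (D ∩ K) := by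
    intro K hK
    obtain ⟨U, hU, hKU, hUc⟩ := exists_isOpen_superset_and_isCompact_closure hK
    refine eq_of_eq_on_isOpen hU ?_ (fun W hW hWU => ?_) (hD.inter hK.measurableSet)
      (Set.inter_subset_right.trans hKU)
    · exact ne_top_of_le_ne_top (hμ.isBorel hn _ hUc)
        (μ.mono hU.measurableSet hUc.measurableSet subset_closure)
    · have hWc := hUc.of_isClosed_subset isClosed_closure (closure_mono hWU)
      exact hμ.eq_of_isOpen hn hν hW (hμl.innerRegularAt hW hWc) (hνl.innerRegularAt hW hWc)
  refine (hμw D hD).unique ?_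
  have hset : {a | ∃ K, IsCompact K ∧ a = μ (D ∩ K)} = {a | ∃ K, IsCompact K ∧ a = ν (D ∩ K)} :=
    Set.ext fun a => exists_congr fun K => and_congr_right fun hc => by rw [hK K hc]
  rw [hset]
  exact hνw D hD

/-- If all open `V ⊇ D` had measure `∞`, outer regularity would give `ν D = ∞`. Inside a `V` of
finite measure, agreement at open sets extends to Borel sets. -/
theorem IsRegularBorel.eq_of_ne_top (hn : IsNormalSpace E) (hνr : ν.IsRegularBorel)
    (hν : ν.Represents π) (hμ : μ.Represents π) (hμi : ∀ V, IsOpen V → μ.InnerRegularAt V)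
    {D : Set X} (hD : MeasurableSet D) (hfin : ν D ≠ ⊤) : ν D = μ D := by
  obtain ⟨V, hV, hDV, hVfin⟩ : ∃ V, IsOpen V ∧ D ⊆ V ∧ ν V ≠ ⊤ := by
    by_contra! hc
    refine hfin (top_le_iff.1 ((hνr.outerRegular D hD).2 ?_))
    rintro _ ⟨V, hV, hDV, rfl⟩
    exact (hc V hV hDV).ge
  exact eq_of_eq_on_isOpen hV hVfin
    (fun W hW _ => hν.eq_of_isOpen hn hμ hW (hνr.innerRegular W hW) (hμi W hW)) hD hDV

end ExtMeasure

end OrderedMeasure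

theorem mainTheorem3 {X : Type*} [TopologicalSpace X] [T2Space X] [LocallyCompactSpace X]
    [MeasurableSpace X] [BorelSpace X]
    {E : Type*} [AddCommGroup E] [PartialOrder E] [IsOrderedAddMonoid E] [Module ℝ E]
    [IsOrderedModule ℝ E]
    (hE_complete : OrderedMeasure.IsMonotoneComplete E)
    (hE_normal : OrderedMeasure.IsNormalSpace E)
    (π : C_c(X, ℝ) →ₚ[ℝ] E) :
    ∃ μ : OrderedMeasure.ExtMeasure X E,
      -- the three properties
      μ.IsLocallyRegularBorel ∧
      (∀ D, MeasurableSet D → μ.WeaklyInnerRegularAt D) ∧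
      μ.Represents π ∧
      -- uniqueness
      (∀ μ' : OrderedMeasure.ExtMeasure X E, μ'.IsLocallyRegularBorel →
        (∀ D, MeasurableSet D → μ'.WeaklyInnerRegularAt D) → μ'.Represents π → μ' = μ) ∧
      μ.IsQuasiRegularBorel ∧
      -- comparison with the regular Borel measures that represent `π`
      ∀ ν : OrderedMeasure.ExtMeasure X E, ν.IsRegularBorel → ν.Represents π →
        (∀ D, MeasurableSet D → μ D ≤ ν D) ∧
        (∀ V, IsOpen V → ν V = μ V) ∧
        (∀ K, IsCompact K → ν K = μ K) ∧
        (∀ D, MeasurableSet D → ν D ≠ ⊤ → ν D = μ D) ∧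
        (∀ D, MeasurableSet D → μ D = ⊤ → ν D = μ D) := by
  have hq := OrderedMeasure.rieszExtMeasure_isQuasiRegularBorel π hE_complete hE_normal
  have hl := OrderedMeasure.rieszExtMeasure_isLocallyRegularBorel π hE_complete hE_normal
  have hr := OrderedMeasure.rieszExtMeasure_represents π hE_complete hE_normal
  refine ⟨OrderedMeasure.rieszExtMeasure π hE_complete hE_normal, hl, hq.weaklyInnerRegular, hr,
    fun μ' hl' hw' hr' => hr'.eq_of_isLocallyRegularBorel hE_normal hr hl' hl hw'
      hq.weaklyInnerRegular, hq, fun ν hν hνr => ?_⟩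
  have hfin : ∀ D, MeasurableSet D → ν D ≠ ⊤ →
      ν D = OrderedMeasure.rieszExtMeasure π hE_complete hE_normal D := fun D hD hD' =>
    hν.eq_of_ne_top hE_normal hνr hr hq.innerRegular hD hD'
  refine ⟨fun D hD => ?_, fun V hV => ?_, fun K hK => ?_, hfin, fun D hD hD' => ?_⟩
  · by_cases h : ν D = ⊤
    · exact h ▸ le_top
    · exact (hfin D hD h).ge
  · exact hνr.eq_of_isOpen hE_normal hr hV (hν.innerRegular V hV) (hq.innerRegular V hV)
  · exact hfin K hK.measurableSet (hν.isBorel K hK)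
  · by_contra h
    have hne : ν D ≠ ⊤ := fun hc => h (hc.trans hD'.symm)
    exact h (hfin D hD hne)
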